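/- Let $n\ge 0$ and $d>n+2$. Let $(X,\epsilon)$ be a random pair in $\mathbb R^d\times\mathbb R$ with $\mathbb E\|X\|_2^2<\infty$, and with $\mathbb E[\epsilon\mid X]=0$ and $\mathbb E[\epsilon^2\mid X]=\sigma^2$, where we are in the noiseless case $\sigma^2=0$. For $\theta\in\mathbb R^d$ put $Y=X^\top\theta+\epsilon$, and let $(X_i,Y_i)_{1\le i\le n}$ be i.i.d. copies of $(X,Y)$, independent of it. Let $\Sigma=\mathbb E[XX^\top]$, and assume that $\Sigma$ is invertible and that the latent covariate $Z=\Sigma^{-1/2}X$ has isotropic direction: $Z/\|Z\|_2$ is uniformly distributed on the unit sphere $\mathbb S^{d-1}$. A linear prediction rule is $\hat f(x)=\sum_{i=1}^n l_i(x)Y_i$, where the weights $l_i(x)$ are measurable functions of $x$, of $X_1,\dots,X_n$ and of a source of randomness independent of the data. For a function $f$ let $R(f)=\mathbb E[(Y-f(X))^2]$, and let $\mathcal E_{\sigma^2}(\hat f)=\mathbb E[R(\hat f)]-R(f_\star)$ with $f_\star(x)=x^\top\theta$, where the outer expectation is over the training set and the randomness of the rule. Let $\nu$ be any probability distribution on $\mathbb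 R^d$ with finite second moment (for example supported on an ellipsoid $\{\theta:\|A\theta\|_2=1\}$), let $H=\mathbb E_{\theta\sim\nu}[\theta\theta^\top]$ and $\Sigma_H=H^{1/2}\Sigma H^{1/2}$, with eigenvalues $\lambda_1(\Sigma_H)\ge\dots\ge\lambda_d(\Sigma_H)\ge 0$, and define the optimal averaged excess risk $$\bar{\mathcal E}(\Sigma_H;\sigma^2)=\inf_{\hat f}\ \mathbb E_{\theta\sim\nu}\big[\mathcal E_{\sigma^2}(\hat f)\big],$$ the infimum being over all linear prediction rules. For $k\ge 0$ let $R_k=\sum_{j>k}\lambda_j(\Sigma_H)$. Then $$R_n\ \le\ \bar{\mathcal E}(\Sigma_H;0)\ \le\ \min_{0\le k<n-1}\frac{n-1}{n-k-1}\,R_k ,$$ where the minimum over the empty set (the case $n\le 1$) is $+\infty$. -/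

import Mathlib

open MeasureTheory
open scoped ENNReal MatrixOrder

namespace LinReg

/-- The covariate space `ℝ^d` with its Euclidean structure. -/
abbrev Vec (d : ℕ) : Type := EuclideanSpace ℝ (Fin d)

/-- The matrix `E[x xᵀ]` of (uncentred) second moments of a law on `ℝ^d`. -/
noncomputable def secondMoment {d : ℕ} (μ : Measure (Vec d)) : Matrix (Fin d) (Fin d) ℝ :=
  Matrix.of fun i j => ∫ x, x i * x j ∂μ

/-- `P` is the joint law of a covariate `X` and a noise `ε` of the linear model
`Y = Xᵀθ + ε`: both are square integrable, `E[ε | X] = 0` and `E[ε² | X] = σ²`. -/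
structure WellSpecified {d : ℕ} (P : Measure (Vec d × ℝ)) (σ2 : ℝ) : Prop where
  memLp_covariate : MemLp (fun x : Vec d => x) 2 P.fst
  memLp_noise : MemLp (fun z : Vec d × ℝ => z.2) 2 P
  condExp_noise :
    P[fun z : Vec d × ℝ => z.2 | MeasurableSpace.comap Prod.fst inferInstance] =ᵐ[P]
      fun _ => 0
  condExp_noise_sq :
    P[fun z : Vec d × ℝ => z.2 ^ 2 | MeasurableSpace.comap Prod.fst inferInstance] =ᵐ[P]
      fun _ => σ2

/-- The response `Y = Xᵀθ + ε` attached to `z = (X, ε)`. -/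
noncomputable def response {d : ℕ} (θ : Vec d) (z : Vec d × ℝ) : ℝ :=
  inner ℝ z.1 θ + z.2

/-- A linear prediction rule `f̂(x) = ∑ᵢ lᵢ(x) Yᵢ`. The weight `lᵢ(x)` may depend, measurably,
on the training covariates `(X₁, …, Xₙ)` and on a seed drawn independently of everything else,
but not on the responses and not on `θ`. -/
structure LinearRule (n d : ℕ) where
  Seed : Type
  [measurableSpaceSeed : MeasurableSpace Seed]
  seedLaw : Measure Seed
  [isProbabilityMeasure_seedLaw : IsProbabilityMeasure seedLaw]
  weight : Fin n → Vec d → (Fin n → Vec d) → Seed → ℝ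
  measurable_weight : ∀ i,
    Measurable fun p : Vec d × (Fin n → Vec d) × Seed => weight i p.1 p.2.1 p.2.2

attribute [instance] LinearRule.measurableSpaceSeed LinearRule.isProbabilityMeasure_seedLaw

/-- The predictor `x ↦ ∑ᵢ lᵢ(x) Yᵢ` that the rule returns on the training set
`(Xᵢ, Xᵢᵀθ + εᵢ)`, where `D i = (Xᵢ, εᵢ)`, with seed `s`. -/
noncomputable def LinearRule.predictor {n d : ℕ} (f : LinearRule n d) (θ : Vec d)
    (D : Fin n → Vec d × ℝ) (s : f.Seed) (x : Vec d) : ℝ :=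
  ∑ i, f.weight i x (fun j => (D j).1) s * response θ (D i)

/-- The population risk `R(g) = E[(Y - g(X))²]`. -/
noncomputable def risk {d : ℕ} (P : Measure (Vec d × ℝ)) (θ : Vec d) (g : Vec d → ℝ) : ℝ≥0∞ :=
  ∫⁻ z, ENNReal.ofReal ((response θ z - g z.1) ^ 2) ∂P

/-- The averaged excess risk `E[R(f̂)] - R(f⋆)` with `f⋆(x) = xᵀθ`; the expectation is over
`n` i.i.d. training points and over the seed of the rule.
(In a well-specified model `R(f⋆) ≤ E[R(f̂)]` and `R(f⋆) = σ²` is finite, so that the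
subtraction in `[0, ∞]` is the ordinary one.) -/
noncomputable def excessRisk {n d : ℕ} (P : Measure (Vec d × ℝ)) (θ : Vec d)
    (f : LinearRule n d) : ℝ≥0∞ :=
  (∫⁻ D, ∫⁻ s, risk P θ (f.predictor θ D s) ∂f.seedLaw ∂(Measure.pi fun _ : Fin n => P))
    - risk P θ (fun x => inner ℝ x θ)

/-- The optimal averaged excess risk `inf_f̂ E_{θ ∼ ν}[excess risk of f̂]` over all linear
prediction rules based on `n` samples. -/
noncomputable def optimalExcessRisk {d : ℕ} (n : ℕ) (P : Measure (Vec d × ℝ))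
    (ν : Measure (Vec d)) : ℝ≥0∞ :=
  ⨅ f : LinearRule n d, ∫⁻ θ, excessRisk P θ f ∂ν

/-- The matrix `Σ_H = H^{1/2} Σ H^{1/2}`, with `Σ = E[X Xᵀ]` and `H = E_ν[θ θᵀ]`. -/
noncomputable def sigmaH {d : ℕ} (P : Measure (Vec d × ℝ)) (ν : Measure (Vec d)) :
    Matrix (Fin d) (Fin d) ℝ :=
  CFC.sqrt (secondMoment ν) * secondMoment P.fst * CFC.sqrt (secondMoment ν)

theorem sigmaH_isHermitian {d : ℕ} (P : Measure (Vec d × ℝ)) (ν : Measure (Vec d)) :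
    (sigmaH P ν).IsHermitian := by
  have h1 : (CFC.sqrt (secondMoment ν)).conjTranspose = CFC.sqrt (secondMoment ν) :=
    (Matrix.nonneg_iff_posSemidef.mp (CFC.sqrt_nonneg (secondMoment ν))).1
  have h2 : (secondMoment P.fst).conjTranspose = secondMoment P.fst := by
    ext i j
    simp [secondMoment, Matrix.conjTranspose_apply, mul_comm]
  unfold sigmaH Matrix.IsHermitian
  rw [Matrix.conjTranspose_mul, Matrix.conjTranspose_mul, h1, h2, Matrix.mul_assoc]

/-- `R_k = ∑_{j > k} λ_j(A)`, where `λ_1 ≥ λ_2 ≥ … ≥ λ_d` are the eigenvalues of `A`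
with multiplicity. (`eigenvalues₀` lists them in decreasing order starting from index `0`,
so that `λ_j` is entry `j - 1`.) -/
noncomputable def eigenTail {d : ℕ} {A : Matrix (Fin d) (Fin d) ℝ} (hA : A.IsHermitian)
    (k : ℕ) : ℝ :=
  ∑ j : Fin (Fintype.card (Fin d)), if k ≤ (j : ℕ) then hA.eigenvalues₀ j else 0

/-- The uniform probability distribution on the unit sphere of `ℝ^d`, as a law on `ℝ^d`:
the normalized surface measure. -/
noncomputable def uniformSphere (d : ℕ) : Measure (Vec d) :=
  let S : Measure (Metric.sphere (0 : Vec d) 1) := (volume : Measure (Vec d)).toSphere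
  ((S Set.univ)⁻¹ • S).map Subtype.val

/-- The latent covariate `z = Σ^{-1/2} x`, where `Σ = E[X Xᵀ]`. -/
noncomputable def latent {d : ℕ} (P : Measure (Vec d × ℝ)) (x : Vec d) : Vec d :=
  Matrix.toEuclideanLin (CFC.sqrt (secondMoment P.fst))⁻¹ x

/-- Isotropic latent covariate: `Z = Σ^{-1/2} X` satisfies `Z / ‖Z‖ ∼ U(S^{d-1})`. -/
def IsotropicLatent {d : ℕ} (P : Measure (Vec d × ℝ)) : Prop :=
  P.fst.map (fun x => ‖latent P x‖⁻¹ • latent P x) = uniformSphere d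

end LinReg

/-!
Why the bounds hold. Write `Σ` for the covariance of the covariate, `z = Σ^{-1/2} x` for the latent
covariate and `y = x - ∑ᵢ lᵢ(x) Xᵢ` for the residual of a linear rule. Without noise the error of
the rule at `θ` is `⟪y, θ⟫`, so its squared error averaged over `θ` is `yᵀ H y`
(`LinReg.lintegral_excessRisk`). In an orthonormal eigenbasis `b` of `Σ^{1/2} H Σ^{1/2}`, a matrix
with the same spectrum as `Σ_H = H^{1/2} Σ H^{1/2}`, this equals `∑ⱼ λⱼ ⟪bⱼ, Σ^{-1/2} y⟫²`
(`LinReg.exists_spectral_decomposition`), and `z` has identity covariance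
(`LinReg.lintegral_inner_latent_sq`).

*Lower bound.* For fixed training points and seed, `Σ^{-1/2} y` differs from `z` by an element of a
subspace of dimension at most `n`. Let `B` be the square root of the quadratic form. Projecting `B z`
orthogonally to the image of that subspace under `B` gives a mean square `∑ⱼ λⱼ sⱼ` with
`0 ≤ sⱼ ≤ 1` and `∑ⱼ sⱼ ≥ d - n`, which is at least the sum of the `d - n` smallest eigenvalues
(`LinReg.ofReal_tail_le_lintegral`).

*Upper bound.* A single rule is exhibited for each `k`. Its seed holds `n` independent radii with the
law of the norm of a Gaussian vector. Multiplying them by the uniform latent directions of the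
training points produces independent standard Gaussian vectors, whatever the law of the latent
lengths (`LinReg.measurePreserving_rows_rescaledLatent`), so the coordinates in the basis `b` form a
Gaussian array with independent rows `Aⱼ` in `ℝⁿ`. The rule chooses the weights of least norm that
reproduce the first `k` coordinates of `z`, as in the analysis of the randomized range finder of
Halko, Martinsson and Tropp. With `w_m` the dual vectors of the first `k` rows, the `j`-th remaining
coordinate has mean square `1 + ∑ₘ ⟪w_m, Aⱼ⟫²`, whose expectation is `1 + ∑ₘ E‖w_m‖²`. Finally
`‖w_m‖⁻²` is the squared norm of a standard Gaussian in dimension `n - k + 1`, whence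
`E‖w_m‖² = 1 / (n - k - 1)` (`LinReg.lintegral_norm_sq_dualVec_le`, of which only the upper bound is
needed) and `1 + k / (n - k - 1) = (n - 1) / (n - k - 1)`.
-/

namespace LinReg

open ProbabilityTheory Set

/-! ### Gaussian inverse moments -/

lemma integral_exp_neg_mul_sq_gaussianReal {t : ℝ} (ht : 0 ≤ t) :
    ∫ x, Real.exp (-t * x ^ 2) ∂(gaussianReal 0 1) = (1 + 2 * t) ^ (-(1 / 2) : ℝ) := by
  rw [integral_gaussianReal_eq_integral_smul one_ne_zero]
  have h : ∀ x : ℝ, gaussianPDFReal 0 1 x • Real.exp (-t * x ^ 2)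
      = (√(2 * Real.pi))⁻¹ * Real.exp (-(t + 1 / 2) * x ^ 2) := by
    intro x
    simp only [gaussianPDFReal, NNReal.coe_one, mul_one, sub_zero, smul_eq_mul]
    rw [mul_assoc, ← Real.exp_add]
    ring_nf
  simp_rw [h]
  rw [integral_const_mul, integral_gaussian, ← Real.sqrt_inv, ← Real.sqrt_mul (by positivity),
    Real.rpow_neg (by positivity), ← Real.sqrt_eq_rpow, ← Real.sqrt_inv]
  congr 1
  have := Real.pi_pos
  field_simp
  ring

section
variable {E : Type*} [NormedAddCommGroup E] [InnerProductSpace ℝ E] [FiniteDimensional ℝ E]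
  [MeasurableSpace E] [BorelSpace E]

lemma integral_exp_neg_mul_norm_sq_stdGaussian {t : ℝ} (ht : 0 ≤ t) :
    ∫ x, Real.exp (-t * ‖x‖ ^ 2) ∂(stdGaussian E)
      = (1 + 2 * t) ^ (-(Module.finrank ℝ E / 2) : ℝ) := by
  rw [stdGaussian, integral_map (Measurable.aemeasurable (by fun_prop))
    (Measurable.aestronglyMeasurable (by fun_prop))]
  have h : ∀ x : Fin (Module.finrank ℝ E) → ℝ,
      Real.exp (-t * ‖∑ i, x i • stdOrthonormalBasis ℝ E i‖ ^ 2)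
        = ∏ i, Real.exp (-t * x i ^ 2) := by
    intro x
    rw [← Real.exp_sum, ← Finset.mul_sum, ← (stdOrthonormalBasis ℝ E).sum_sq_inner_right]
    simp [inner_sum, inner_smul_right, OrthonormalBasis.inner_eq_ite]
  simp_rw [h]
  rw [integral_fintype_prod_eq_prod (f := fun _ x => Real.exp (-t * x ^ 2))]
  simp_rw [integral_exp_neg_mul_sq_gaussianReal ht]
  rw [Finset.prod_const, Finset.card_univ, Fintype.card_fin, ← Real.rpow_mul_natCast (by positivity)]
  congr 1
  ring

lemma map_orthogonalProjection_stdGaussian (V : Submodule ℝ E) :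
    (stdGaussian E).map V.orthogonalProjectionOnto = stdGaussian V := by
  apply Measure.ext_of_charFun
  ext t
  rw [charFun_stdGaussian, charFun_apply, integral_map (by fun_prop)
    (Measurable.aestronglyMeasurable (by fun_prop))]
  have := charFun_stdGaussian (E := E) t
  rw [charFun_apply] at this
  simp_rw [Submodule.coe_inner, ← Submodule.coe_norm] at this ⊢
  simpa only [← Submodule.coe_inner, Submodule.inner_orthogonalProjectionOnto_eq_of_mem_right,
    Submodule.coe_norm] using this
end

lemma lintegral_exp_neg_mul {s : ℝ} (hs : 0 ≤ s) :
    ∫⁻ t in Ioi (0 : ℝ), ENNReal.ofReal (Real.exp (-t * s)) = (ENNReal.ofReal s)⁻¹ := by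
  rcases hs.eq_or_lt with rfl | hs
  · simp
  · have h : ∀ t : ℝ, -t * s = -s * t := fun t => by ring
    simp_rw [h]
    rw [← ofReal_integral_eq_lintegral_ofReal, ← ENNReal.ofReal_inv_of_pos hs]
    · rw [integral_exp_mul_Ioi (neg_lt_zero.2 hs)]
      simp [neg_div]
    · exact integrableOn_exp_mul_Ioi (neg_lt_zero.2 hs) 0
    · filter_upwards with t using (Real.exp_pos _).le

lemma lintegral_one_add_two_mul_rpow {m : ℝ} (hm : 2 < m) :
    ∫⁻ t in Ioi (0 : ℝ), ENNReal.ofReal ((1 + 2 * t) ^ (-(m / 2)))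
      = ENNReal.ofReal (1 / (m - 2)) := by
  have hm2 : m - 2 ≠ 0 := by linarith
  have hd : ∀ t ∈ Ici (0 : ℝ), HasDerivAt (fun t : ℝ => -(1 + 2 * t) ^ (1 - m / 2) / (m - 2))
      ((1 + 2 * t) ^ (-(m / 2))) t := by
    intro t ht
    have ht : 0 ≤ t := ht
    have h1 : HasDerivAt (fun t : ℝ => 1 + 2 * t) 2 t := by
      simpa using ((hasDerivAt_id t).const_mul 2).const_add 1
    refine ((h1.rpow_const (p := 1 - m / 2)
      (Or.inl (by positivity))).neg.div_const (m - 2)).congr_deriv ?_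
    rw [show 1 - m / 2 - 1 = -(m / 2) by ring]
    field_simp
    ring
  have hlim : Filter.Tendsto (fun t : ℝ => -(1 + 2 * t) ^ (1 - m / 2) / (m - 2)) Filter.atTop
      (nhds 0) := by
    have h1 : Filter.Tendsto (fun t : ℝ => 1 + 2 * t) Filter.atTop Filter.atTop :=
      Filter.tendsto_atTop_add_const_left _ _ (Filter.tendsto_id.const_mul_atTop two_pos)
    have := ((tendsto_rpow_neg_atTop (y := m / 2 - 1) (by linarith)).comp h1).neg.div_const (m - 2)
    simpa [Function.comp_def] using this
  have hpos : ∀ t ∈ Ioi (0 : ℝ), 0 ≤ (1 + 2 * t) ^ (-(m / 2)) := fun t ht => by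
    have ht : 0 < t := ht
    positivity
  rw [← ofReal_integral_eq_lintegral_ofReal (integrableOn_Ioi_deriv_of_nonneg' hd hpos hlim)
    ((ae_restrict_iff' measurableSet_Ioi).2 (.of_forall hpos)),
    integral_Ioi_of_hasDerivAt_of_nonneg' hd hpos hlim]
  congr 1
  simp [neg_div]

section
variable {E : Type*} [NormedAddCommGroup E] [InnerProductSpace ℝ E] [FiniteDimensional ℝ E]
  [MeasurableSpace E] [BorelSpace E]

/-- The inverse moment `E ‖g‖⁻² = 1 / (m - 2)` of a standard Gaussian vector in dimension `m ≥ 3`,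
computed from `s⁻¹ = ∫₀^∞ exp (-t s) dt` and the Laplace transform of `‖g‖²`. -/
lemma lintegral_inv_norm_sq_stdGaussian (h : 2 < Module.finrank ℝ E) :
    ∫⁻ x, (ENNReal.ofReal (‖x‖ ^ 2))⁻¹ ∂(stdGaussian E)
      = ENNReal.ofReal (1 / ((Module.finrank ℝ E : ℝ) - 2)) := by
  simp_rw [← fun x : E => lintegral_exp_neg_mul (sq_nonneg ‖x‖)]
  rw [lintegral_lintegral_swap (Measurable.aemeasurable (by fun_prop)),
    ← lintegral_one_add_two_mul_rpow (by exact_mod_cast h)]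
  refine setLIntegral_congr_fun measurableSet_Ioi fun t ht => ?_
  have ht : 0 < t := ht
  rw [← ofReal_integral_eq_lintegral_ofReal, integral_exp_neg_mul_norm_sq_stdGaussian ht.le]
  · refine Integrable.of_bound (C := 1) (Measurable.aestronglyMeasurable (by fun_prop))
      (.of_forall fun x => ?_)
    rw [Real.norm_of_nonneg (Real.exp_pos _).le, Real.exp_le_one_iff]
    nlinarith [sq_nonneg ‖x‖]
  · filter_upwards with x using (Real.exp_pos _).le

lemma lintegral_inv_norm_sq_orthogonalProjection_stdGaussian (V : Submodule ℝ E)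
    (h : 2 < Module.finrank ℝ V) :
    ∫⁻ x, (ENNReal.ofReal (‖V.orthogonalProjectionOnto x‖ ^ 2))⁻¹ ∂(stdGaussian E)
      = ENNReal.ofReal (1 / ((Module.finrank ℝ V : ℝ) - 2)) := by
  rw [← lintegral_inv_norm_sq_stdGaussian h, ← map_orthogonalProjection_stdGaussian V,
    lintegral_map (by fun_prop) (by fun_prop)]

/-- A standard Gaussian vector almost surely avoids a subspace of codimension at least `3`.
(Any proper subspace is null; this case falls out of the inverse moment.) -/
lemma stdGaussian_ae_notMem (W : Submodule ℝ E) (h : 2 < Module.finrank ℝ Wᗮ) :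
    ∀ᵐ x ∂(stdGaussian E), x ∉ W := by
  have h1 := lintegral_inv_norm_sq_orthogonalProjection_stdGaussian Wᗮ h
  filter_upwards [ae_lt_top (by fun_prop) (h1.trans_ne ENNReal.ofReal_ne_top)] with x hx hW
  rw [Submodule.orthogonalProjectionOnto_eq_zero_iff.2 (by simpa using hW)] at hx
  simp at hx
end

/-- Peeling off the integral over one coordinate of a product measure. -/
lemma lintegral_pi_le_of_update {ι : Type*} [Fintype ι] [DecidableEq ι] {X : ι → Type*}
    [∀ i, MeasurableSpace (X i)] {μ : ∀ i, Measure (X i)} [∀ i, SigmaFinite (μ i)] (i : ι)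
    {f g : (∀ i, X i) → ℝ≥0∞} (hf : Measurable f) (hg : Measurable g)
    (h : ∀ x, ∫⁻ y, f (Function.update x i y) ∂μ i ≤ ∫⁻ y, g (Function.update x i y) ∂μ i) :
    ∫⁻ x, f x ∂Measure.pi μ ≤ ∫⁻ x, g x ∂Measure.pi μ := by
  refine lintegral_le_of_lmarginal_le {i} hf hg fun x => ?_
  rw [lmarginal_singleton, lmarginal_singleton]
  exact h x

/-- The coordinates, in an orthonormal basis, of `n` independent standard Gaussian vectors form
an array of independent standard Gaussians, so its rows are again independent standard Gaussian
vectors. -/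
lemma map_transpose_pi_stdGaussian {n d : ℕ} (b : OrthonormalBasis (Fin d) ℝ (Vec d)) :
    (Measure.pi fun _ : Fin n => stdGaussian (Vec d)).map
        (fun g (j : Fin d) => (WithLp.toLp 2 fun i => inner ℝ (b j) (g i) : Vec n))
      = Measure.pi fun _ : Fin d => stdGaussian (Vec n) := by
  have hm : Measurable fun (g : Fin n → Vec d) (j : Fin d) =>
      (WithLp.toLp 2 fun i => inner ℝ (b j) (g i) : Vec n) := by fun_prop
  suffices h : ((Measure.pi fun _ : Fin n => stdGaussian (Vec d)).map
        (fun g (j : Fin d) => (WithLp.toLp 2 fun i => inner ℝ (b j) (g i) : Vec n))).map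
          (WithLp.toLp 2)
      = (Measure.pi fun _ : Fin d => stdGaussian (Vec n)).map (WithLp.toLp 2) by
    have h2 := congrArg (Measure.map (WithLp.ofLp)) h
    rw [Measure.map_map (by fun_prop) (by fun_prop),
      Measure.map_map (g := WithLp.ofLp) (f := WithLp.toLp 2) (by fun_prop) (by fun_prop)] at h2
    simpa [Function.comp_def] using h2
  apply Measure.ext_of_charFun
  ext t
  -- transposition is an isometry, so both laws have characteristic function `exp (-‖t‖² / 2)`;
  -- `u` is the array whose pairing with `g` is the pairing of `t` with the transpose of `g`
  set u : PiLp 2 fun _ : Fin n => Vec d := WithLp.toLp 2 fun i => ∑ j, t j i • b j with hu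
  have hc := charFun_pi (μ := fun _ : Fin n => stdGaussian (Vec d)) u
  rw [charFun_pi]
  rw [charFun_apply, integral_map (by fun_prop) (Measurable.aestronglyMeasurable (by fun_prop))]
    at hc
  rw [charFun_apply, integral_map (by fun_prop) (Measurable.aestronglyMeasurable (by fun_prop)),
    integral_map hm.aemeasurable (Measurable.aestronglyMeasurable (by fun_prop))]
  have e1 : ∀ g : Fin n → Vec d, inner ℝ (WithLp.toLp 2 fun j : Fin d =>
      (WithLp.toLp 2 fun i => inner ℝ (b j) (g i) : Vec n)) t = inner ℝ (WithLp.toLp 2 g) u := by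
    intro g
    rw [PiLp.inner_apply, PiLp.inner_apply]
    simp_rw [PiLp.inner_apply (𝕜 := ℝ) (f := fun _ : Fin n => ℝ), hu, inner_sum, inner_smul_right]
    rw [Finset.sum_comm]
    simp_rw [real_inner_comm (b _)]
    simp
  simp_rw [e1, hc, charFun_stdGaussian, ← Complex.exp_sum]
  congr 1
  simp_rw [neg_div, Finset.sum_neg_distrib, ← Finset.sum_div]
  congr 2
  norm_cast
  have e2 : ∀ i, ‖u i‖ ^ 2 = ∑ j, t j i ^ 2 := by
    intro i
    rw [← b.sum_sq_inner_right]
    simp [hu, inner_sum, inner_smul_right, b.inner_eq_ite]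
  simp_rw [e2, EuclideanSpace.norm_sq_eq]
  rw [Finset.sum_comm]
  simp

/-! ### Dual vectors of Gaussian rows -/

/-- The basis of `span R` dual to `R`: `⟪dualVec R m, R q⟫ = δ_{mq}` when `R` is linearly
independent. These are the columns of the Moore–Penrose inverse of the matrix with rows `R`.
If `R` is linearly dependent, its Gram matrix is singular and `dualVec R = 0` by the convention
for matrix inverses. -/
noncomputable def dualVec {k n : ℕ} (R : Fin k → Vec n) (m : Fin k) : Vec n :=
  ∑ p, (Matrix.gram ℝ R)⁻¹ m p • R p

lemma inner_dualVec {k n : ℕ} {R : Fin k → Vec n} (hR : LinearIndependent ℝ R) (m q : Fin k) :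
    inner ℝ (dualVec R m) (R q) = if m = q then 1 else 0 := by
  have h : ((Matrix.gram ℝ R)⁻¹ * Matrix.gram ℝ R) m q = if m = q then 1 else 0 := by
    rw [Matrix.nonsing_inv_mul _ (Matrix.det_gram_ne_zero_iff_linearIndependent.2 hR).isUnit,
      Matrix.one_apply]
  rw [← h, Matrix.mul_apply, dualVec, sum_inner]
  simp [real_inner_smul_left, Matrix.gram_apply]

lemma dualVec_of_not_linearIndependent {k n : ℕ} {R : Fin k → Vec n}
    (hR : ¬ LinearIndependent ℝ R) (m : Fin k) : dualVec R m = 0 := by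
  rw [← Matrix.det_gram_ne_zero_iff_linearIndependent, not_not] at hR
  simp [dualVec, Matrix.inv_def, hR]

lemma continuous_gram {k n : ℕ} : Continuous fun R : Fin k → Vec n => Matrix.gram ℝ R :=
  continuous_matrix fun i j => by
    simp only [Matrix.gram_apply]
    fun_prop

lemma measurable_dualVec {k n : ℕ} (m : Fin k) :
    Measurable fun R : Fin k → Vec n => dualVec R m := by
  have h2 : ∀ p, Measurable fun R : Fin k → Vec n => (Matrix.gram ℝ R)⁻¹ m p := fun p => by
    simp only [Matrix.inv_def, Ring.inverse_eq_inv', Matrix.smul_apply, smul_eq_mul]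
    exact continuous_gram.matrix_det.measurable.inv.mul
      (continuous_gram.matrix_adjugate.matrix_elem m p).measurable
  exact Finset.measurable_sum _ fun p _ => (h2 p).smul (measurable_pi_apply p)

/-- `‖dualVec R m‖` is at most the inverse distance of `R m` to the span of the other rows (with
equality when `R` is linearly independent). -/
lemma norm_sq_dualVec_le {k n : ℕ} (R : Fin k → Vec n) (m : Fin k) :
    ENNReal.ofReal (‖dualVec R m‖ ^ 2)
      ≤ (ENNReal.ofReal
          (‖(Submodule.span ℝ (R '' {m}ᶜ))ᗮ.orthogonalProjectionOnto (R m)‖ ^ 2))⁻¹ := by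
  by_cases hR : LinearIndependent ℝ R
  swap
  · simp [dualVec_of_not_linearIndependent hR]
  set V := (Submodule.span ℝ (R '' {m}ᶜ))ᗮ with hV
  set w := dualVec R m with hw
  set q := V.orthogonalProjectionOnto (R m) with hq
  have hwV : w ∈ V := by
    rw [hV, Submodule.mem_orthogonal]
    intro u hu
    induction hu using Submodule.span_induction with
    | mem x hx =>
      obtain ⟨p, hp, rfl⟩ := hx
      rw [real_inner_comm, inner_dualVec hR, if_neg (Ne.symm hp)]
    | zero => simp
    | add x y _ _ hx hy => simp [inner_add_left, hx, hy]
    | smul a x _ hx => simp [inner_smul_left, hx]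
  have hother : ∀ p, p ≠ m → V.orthogonalProjectionOnto (R p) = 0 := by
    intro p hp
    rw [Submodule.orthogonalProjectionOnto_eq_zero_iff]
    exact Submodule.le_orthogonal_orthogonal _ (Submodule.subset_span ⟨p, hp, rfl⟩)
  -- the dual vector is orthogonal to the other rows and lies in the span of all rows, so it is a
  -- multiple of the component of `R m` orthogonal to the other rows
  obtain ⟨a, ha⟩ : ∃ a : ℝ, w = a • (q : Vec n) := by
    refine ⟨(Matrix.gram ℝ R)⁻¹ m m, ?_⟩
    have h1 : V.orthogonalProjectionOnto w = (Matrix.gram ℝ R)⁻¹ m m • q := by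
      rw [hw, dualVec, map_sum, Finset.sum_eq_single m]
      · simp [hq]
      · intro p _ hp
        simp [hother p hp]
      · simp
    rw [← Submodule.coe_smul, ← h1]
    exact (Submodule.starProjection_eq_self_iff.2 hwV).symm
  have h1 : a * ‖q‖ ^ 2 = 1 := by
    have h2 : inner ℝ w (R m) = 1 := by simpa using inner_dualVec hR m m
    rw [ha, real_inner_smul_left, ← Submodule.inner_orthogonalProjectionOnto_eq_of_mem_left,
      real_inner_self_eq_norm_sq] at h2
    exact h2
  have hq0 : 0 < ‖q‖ ^ 2 := by
    rcases (sq_nonneg ‖q‖).eq_or_lt with h | h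
    · rw [← h] at h1
      simp at h1
    · exact h
  rw [← ENNReal.ofReal_inv_of_pos hq0, ha]
  refine ENNReal.ofReal_le_ofReal (le_of_eq ?_)
  rw [norm_smul, mul_pow, Submodule.coe_norm, Real.norm_eq_abs, sq_abs]
  refine eq_inv_of_mul_eq_one_left ?_
  rw [Submodule.coe_norm] at h1
  linear_combination (a * ‖(q : Vec n)‖ ^ 2 + 1) * h1

lemma le_finrank_orthogonal_span {n : ℕ} (s : Finset (Vec n)) :
    n ≤ Module.finrank ℝ (Submodule.span ℝ (s : Set (Vec n)))ᗮ + s.card := by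
  have h1 := Submodule.finrank_add_finrank_orthogonal (Submodule.span ℝ (s : Set (Vec n)))
  have h2 : Module.finrank ℝ (Submodule.span ℝ (s : Set (Vec n))) ≤ s.card :=
    finrank_span_finset_le_card s
  rw [finrank_euclideanSpace, Fintype.card_fin] at h1
  omega

lemma lintegral_inner_sq_stdGaussian {n : ℕ} (w : Vec n) :
    ∫⁻ y, ENNReal.ofReal (inner ℝ w y ^ 2) ∂(stdGaussian (Vec n)) = ENNReal.ofReal (‖w‖ ^ 2) := by
  have h1 := variance_dual_stdGaussian (innerSL ℝ w)
  have h2 : MemLp (innerSL ℝ w) 2 (stdGaussian (Vec n)) := IsGaussian.memLp_dual _ _ 2 (by simp)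
  rw [variance_of_integral_eq_zero h2.aemeasurable (integral_strongDual_stdGaussian _),
    innerSL_apply_norm] at h1
  rw [← h1, ofReal_integral_eq_lintegral_ofReal h2.integrable_sq (.of_forall fun _ => sq_nonneg _)]
  simp

section
variable {ι : Type*} [Fintype ι] [DecidableEq ι]

/-- The Frobenius norm of the pseudo-inverse of a `k × n` Gaussian matrix, one column at a time:
conditionally on the other rows, `‖dualVec m‖⁻²` is the squared norm of a standard Gaussian vector
in dimension `n - k + 1`. -/
lemma lintegral_norm_sq_dualVec_le {k n : ℕ} (hk : k + 1 < n) {e : Fin k → ι}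
    (he : Function.Injective e) (m : Fin k) :
    ∫⁻ A, ENNReal.ofReal (‖dualVec (A ∘ e) m‖ ^ 2)
        ∂(Measure.pi fun _ : ι => stdGaussian (Vec n))
      ≤ ENNReal.ofReal (1 / ((n : ℝ) - k - 1)) := by
  have hw : Measurable fun A : ι → Vec n => dualVec (A ∘ e) m :=
    (measurable_dualVec m).comp (by fun_prop)
  refine (lintegral_pi_le_of_update (e m) (g := fun _ => ENNReal.ofReal (1 / ((n : ℝ) - k - 1)))
    (by fun_prop) (by fun_prop) fun A => ?_).trans (by simp)
  -- resampling row `m` leaves the set `s` of the other rows, and so its span, unchanged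
  set s : Finset (Vec n) := (Finset.univ.erase m).image (A ∘ e) with hs
  have hcard : s.card ≤ k - 1 := Finset.card_image_le.trans (by simp)
  have hrank := le_finrank_orthogonal_span s
  have hk0 : 0 < k := m.pos
  have hrank' : n + 1 ≤ Module.finrank ℝ (Submodule.span ℝ (s : Set (Vec n)))ᗮ + k := by omega
  have hset : ∀ y, (Function.update A (e m) y ∘ e) '' {m}ᶜ = s := by
    intro y
    ext x
    simp only [mem_image, mem_compl_iff, mem_singleton_iff, Function.comp_apply, hs,
      Finset.coe_image, Finset.coe_erase, Finset.coe_univ, mem_sdiff, mem_univ, true_and]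
    refine exists_congr fun p => and_congr_right fun hp => ?_
    rw [Function.update_of_ne (he.ne hp)]
  calc ∫⁻ y, ENNReal.ofReal (‖dualVec (Function.update A (e m) y ∘ e) m‖ ^ 2)
        ∂(stdGaussian (Vec n))
      ≤ ∫⁻ y, (ENNReal.ofReal
          (‖(Submodule.span ℝ (s : Set (Vec n)))ᗮ.orthogonalProjectionOnto y‖ ^ 2))⁻¹
          ∂(stdGaussian (Vec n)) := by
        refine lintegral_mono fun y => ?_
        have := norm_sq_dualVec_le (Function.update A (e m) y ∘ e) m
        rw [hset y] at this
        simpa using this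
    _ = ENNReal.ofReal (1 / ((Module.finrank ℝ (Submodule.span ℝ (s : Set (Vec n)))ᗮ : ℝ) - 2)) :=
        lintegral_inv_norm_sq_orthogonalProjection_stdGaussian _ (by omega)
    _ ≤ ENNReal.ofReal (1 / ((n : ℝ) - k - 1)) := by
        have h1 : (n : ℝ) + 1
            ≤ Module.finrank ℝ (Submodule.span ℝ (s : Set (Vec n)))ᗮ + k := by
          exact_mod_cast hrank'
        have h2 : (k : ℝ) + 1 < n := by exact_mod_cast hk
        exact ENNReal.ofReal_le_ofReal (one_div_le_one_div_of_le (by linarith) (by linarith))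
    _ = ∫⁻ _, ENNReal.ofReal (1 / ((n : ℝ) - k - 1)) ∂(stdGaussian (Vec n)) := by simp

/-- A row outside the range of `e` is independent of the dual vectors, with identity covariance. -/
lemma lintegral_inner_dualVec_sq_le {k n : ℕ} {e : Fin k → ι} (m : Fin k) {j : ι}
    (hj : ∀ p, e p ≠ j) :
    ∫⁻ A, ENNReal.ofReal (inner ℝ (dualVec (A ∘ e) m) (A j) ^ 2)
        ∂(Measure.pi fun _ : ι => stdGaussian (Vec n))
      ≤ ∫⁻ A, ENNReal.ofReal (‖dualVec (A ∘ e) m‖ ^ 2)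
        ∂(Measure.pi fun _ : ι => stdGaussian (Vec n)) := by
  have hw : Measurable fun A : ι → Vec n => dualVec (A ∘ e) m :=
    (measurable_dualVec m).comp (by fun_prop)
  refine lintegral_pi_le_of_update j (by fun_prop) (by fun_prop) fun A => ?_
  have h : ∀ y, Function.update A j y ∘ e = A ∘ e := fun y => by
    ext1 p
    exact Function.update_of_ne (hj p) _ _
  simp [h, lintegral_inner_sq_stdGaussian]

/-- By induction on the number of rows: given that the first `k` rows are independent, the next one
is an independent Gaussian vector, which avoids their span. The Gram determinant serves to express
dependence as a measurable event. -/
lemma ae_linearIndependent_pi_stdGaussian {k n : ℕ} (hk : k + 1 < n) {e : Fin k → ι}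
    (he : Function.Injective e) :
    ∀ᵐ A ∂(Measure.pi fun _ : ι => stdGaussian (Vec n)), LinearIndependent ℝ (A ∘ e) := by
  induction k with
  | zero => exact .of_forall fun A => linearIndependent_empty_type
  | succ k ih =>
    have hmeas : ∀ {r : ℕ} (f : Fin r → ι),
        MeasurableSet {A : ι → Vec n | ¬ LinearIndependent ℝ (A ∘ f)} := by
      intro r f
      simp_rw [← Matrix.det_gram_ne_zero_iff_linearIndependent]
      have : Measurable fun A : ι → Vec n => (Matrix.gram ℝ (A ∘ f)).det :=
        continuous_gram.matrix_det.measurable.comp (by fun_prop)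
      exact (this (measurableSet_singleton 0).compl).compl
    have ih := ih (by omega) (he.comp (Fin.castSucc_injective k))
    rw [ae_iff] at ih ⊢
    refine le_antisymm (ih ▸ ?_) zero_le
    rw [← lintegral_indicator_one (hmeas _), ← lintegral_indicator_one (hmeas _)]
    refine lintegral_pi_le_of_update (e (Fin.last k))
      (measurable_one.indicator (hmeas _)) (measurable_one.indicator (hmeas _)) fun A => ?_
    set s : Finset (Vec n) := Finset.univ.image (A ∘ e ∘ Fin.castSucc) with hs
    have hcard : s.card ≤ k := Finset.card_image_le.trans (by simp)
    have hrank := le_finrank_orthogonal_span s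
    refine lintegral_mono_ae ?_
    filter_upwards [stdGaussian_ae_notMem (Submodule.span ℝ (s : Set (Vec n))) (by omega)]
      with y hy
    by_cases hli : LinearIndependent ℝ (Function.update A (e (Fin.last k)) y ∘ e ∘ Fin.castSucc)
    · have h : Function.update A (e (Fin.last k)) y ∘ e ∘ Fin.castSucc = A ∘ e ∘ Fin.castSucc := by
        ext1 p
        exact Function.update_of_ne (he.ne p.castSucc_lt_last.ne) _ _
      have hsnoc : Function.update A (e (Fin.last k)) y ∘ e
          = Fin.snoc (α := fun _ => Vec n) (A ∘ e ∘ Fin.castSucc) y := by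
        rw [← h]
        ext1 p
        refine Fin.lastCases ?_ (fun p => ?_) p <;> simp
      rw [indicator_of_notMem]
      · exact zero_le
      · rw [mem_ofPred_eq, not_not, hsnoc, linearIndependent_finSnoc]
        rw [h] at hli
        exact ⟨hli, by simpa [hs, Function.comp_def] using hy⟩
    · exact (indicator_le_self' (fun _ _ => zero_le) _).trans_eq (indicator_of_mem hli 1).symm

end

/-! ### Polar decomposition of the Gaussian -/

/-- The radial profile of the standard Gaussian density on `ℝ^d`. -/
noncomputable def gaussianProfile (d : ℕ) (r : ℝ) : ℝ :=
  (2 * Real.pi) ^ (-(d / 2) : ℝ) * Real.exp (-(1 / 2) * r ^ 2)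

lemma gaussianProfile_nonneg (d : ℕ) (r : ℝ) : 0 ≤ gaussianProfile d r := by
  unfold gaussianProfile
  positivity

lemma measurable_gaussianProfile (d : ℕ) : Measurable (gaussianProfile d) := by
  unfold gaussianProfile
  fun_prop

/-- Both sides have the same characteristic function. -/
lemma withDensity_gaussianProfile_eq_stdGaussian (d : ℕ) :
    (volume : Measure (Vec d)).withDensity (fun x => ENNReal.ofReal (gaussianProfile d ‖x‖))
      = stdGaussian (Vec d) := by
  have hm : Measurable fun x : Vec d => gaussianProfile d ‖x‖ :=
    (measurable_gaussianProfile d).comp measurable_norm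
  have hint : Integrable fun x : Vec d => gaussianProfile d ‖x‖ := by
    have h1 := (GaussianFourier.integrable_cexp_neg_mul_sq_norm_add (V := Vec d) (b := 1 / 2)
      (by norm_num) 0 0).norm
    refine (h1.const_mul ((2 * Real.pi) ^ (-(d / 2) : ℝ))).congr (.of_forall fun x => ?_)
    simp only [gaussianProfile, Complex.norm_exp]
    congr 2
    rw [← Complex.ofReal_pow]
    simp [Complex.mul_re, -Complex.ofReal_pow]
  have : IsFiniteMeasure ((volume : Measure (Vec d)).withDensity
      (fun x => ENNReal.ofReal (gaussianProfile d ‖x‖))) :=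
    isFiniteMeasure_withDensity_ofReal hint.2
  apply Measure.ext_of_charFun
  ext t
  rw [charFun_stdGaussian, charFun_apply, integral_withDensity_eq_integral_toReal_smul
    (by fun_prop) (by simp)]
  have h1 := GaussianFourier.integral_cexp_neg_mul_sq_norm_add (V := Vec d) (b := 1 / 2)
    (by norm_num) Complex.I t
  have h2 : ∀ x : Vec d, (ENNReal.ofReal (gaussianProfile d ‖x‖)).toReal •
      Complex.exp (inner ℝ x t * Complex.I)
      = (((2 * Real.pi) ^ (-(d / 2) : ℝ) : ℝ) : ℂ) *
        Complex.exp (-(1 / 2) * ‖x‖ ^ 2 + Complex.I * inner ℝ t x) := by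
    intro x
    rw [ENNReal.toReal_ofReal (gaussianProfile_nonneg _ _), gaussianProfile, Complex.exp_add,
      Complex.real_smul, real_inner_comm]
    push_cast
    ring_nf
  simp_rw [h2]
  have h3 : ((Real.pi : ℂ) / (1 / 2)) ^ ((d : ℂ) / 2) = (((2 * Real.pi) ^ (d / 2 : ℝ) : ℝ) : ℂ) := by
    rw [Complex.ofReal_cpow (by positivity)]
    push_cast
    congr 1
    ring
  rw [integral_const_mul, h1, finrank_euclideanSpace, Fintype.card_fin, h3, ← mul_assoc,
    ← Complex.ofReal_mul, ← Real.rpow_add (by positivity), neg_add_cancel, Real.rpow_zero,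
    Complex.I_sq]
  norm_num

/-- Integration in polar coordinates. -/
lemma lintegral_polar {d : ℕ} (hd : 0 < d) {F : Vec d → ℝ≥0∞} (hF : Measurable F) :
    ∫⁻ x, F x = ∫⁻ u, ∫⁻ r, F ((r : ℝ) • (u : Vec d)) ∂(Measure.volumeIoiPow (d - 1))
      ∂((volume : Measure (Vec d)).toSphere) := by
  have : Nontrivial (Vec d) := by
    have : Nonempty (Fin d) := ⟨⟨0, hd⟩⟩
    infer_instance
  have hmeas : Measurable fun p : Metric.sphere (0 : Vec d) 1 × Ioi (0 : ℝ) =>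
      F ((p.2 : ℝ) • (p.1 : Vec d)) := by fun_prop
  have h1 := (volume : Measure (Vec d)).measurePreserving_homeomorphUnitSphereProd
  rw [finrank_euclideanSpace, Fintype.card_fin] at h1
  rw [← lintegral_prod (μ := (volume : Measure (Vec d)).toSphere) _ hmeas.aemeasurable,
    ← h1.lintegral_comp hmeas]
  conv_lhs => rw [← restrict_compl_singleton (μ := (volume : Measure (Vec d))) 0,
    ← lintegral_subtype_comap (measurableSet_singleton _).compl]
  refine lintegral_congr fun x => ?_
  congr 1
  have hx : ‖(x : Vec d)‖ ≠ 0 := norm_ne_zero_iff.2 x.2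
  simp [smul_smul, hx]

/-- The law of the norm of a standard Gaussian vector. -/
noncomputable def gaussianRadius (d : ℕ) : Measure ℝ :=
  (stdGaussian (Vec d)).map norm

instance (d : ℕ) : IsProbabilityMeasure (gaussianRadius d) :=
  Measure.isProbabilityMeasure_map (by fun_prop)

instance (d : ℕ) : IsFiniteMeasure (uniformSphere d) := by
  rcases eq_or_ne ((volume : Measure (Vec d)).toSphere univ) 0 with h | h
  · rw [Measure.measure_univ_eq_zero] at h
    simp only [uniformSphere, h, smul_zero, Measure.map_zero]
    infer_instance
  · have := Measure.smul_finite (volume : Measure (Vec d)).toSphere (ENNReal.inv_ne_top.2 h)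
    unfold uniformSphere
    infer_instance

/-- Multiplying a uniform direction by an independent Gaussian radius gives a Gaussian vector. -/
lemma map_smul_uniformSphere_prod_gaussianRadius {d : ℕ} (hd : 0 < d) :
    ((uniformSphere d).prod (gaussianRadius d)).map (fun p => p.2 • p.1)
      = stdGaussian (Vec d) := by
  set σ := (volume : Measure (Vec d)).toSphere with hσ
  have : Nontrivial (Vec d) := by
    have : Nonempty (Fin d) := ⟨⟨0, hd⟩⟩
    infer_instance
  have hσ0 : σ univ ≠ 0 := by simpa only [ne_eq, Measure.measure_univ_eq_zero] using
    (volume : Measure (Vec d)).toSphere_ne_zero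
  have hσt : σ univ ≠ ∞ := measure_ne_top _ _
  have hpolar : ∀ F : Vec d → ℝ≥0∞, Measurable F → ∫⁻ x, F x ∂(stdGaussian (Vec d))
      = ∫⁻ u, ∫⁻ r, ENNReal.ofReal (gaussianProfile d r) * F ((r : ℝ) • (u : Vec d))
        ∂(Measure.volumeIoiPow (d - 1)) ∂σ := by
    intro F hF
    have hm := measurable_gaussianProfile d
    rw [← withDensity_gaussianProfile_eq_stdGaussian, lintegral_withDensity_eq_lintegral_mul _
      (by fun_prop) hF, lintegral_polar hd (by fun_prop)]
    refine lintegral_congr fun u => lintegral_congr fun r => ?_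
    have hr : (0 : ℝ) < r := r.2
    simp [norm_smul, abs_of_pos hr]
  refine Measure.ext_of_lintegral _ fun F hF => ?_
  have hm := measurable_gaussianProfile d
  rw [lintegral_map hF (by fun_prop), lintegral_prod _ (by fun_prop), uniformSphere,
    lintegral_map (by fun_prop) (by fun_prop), lintegral_smul_measure, hpolar F hF]
  -- in polar coordinates the law of the radius has density proportional to the profile
  have h1 : ∀ u : Metric.sphere (0 : Vec d) 1, ∫⁻ r, F (r • (u : Vec d)) ∂(gaussianRadius d)
      = σ univ * ∫⁻ r, ENNReal.ofReal (gaussianProfile d r) * F ((r : ℝ) • (u : Vec d))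
        ∂(Measure.volumeIoiPow (d - 1)) := by
    intro u
    rw [gaussianRadius, lintegral_map (by fun_prop) (by fun_prop),
      hpolar (fun x => F (‖x‖ • (u : Vec d))) (by fun_prop)]
    rw [mul_comm, ← lintegral_const]
    refine lintegral_congr fun v => lintegral_congr fun r => ?_
    have hr : (0 : ℝ) < r := r.2
    simp [norm_smul, abs_of_pos hr]
  simp_rw [h1]
  rw [lintegral_const_mul _ (by fun_prop), smul_eq_mul, ← mul_assoc, ENNReal.inv_mul_cancel hσ0 hσt,
    one_mul]

/-! ### Second moments and the latent covariate -/

section secondMoment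
variable {d : ℕ} {μ : Measure (Vec d)}

lemma integral_inner_sq_eq_dotProduct (hμ : MemLp (fun x : Vec d => x) 2 μ) (v : Vec d) :
    ∫ x, inner ℝ v x ^ 2 ∂μ = v.ofLp ⬝ᵥ (secondMoment μ).mulVec v.ofLp := by
  have hc : ∀ i, MemLp (fun x : Vec d => x i) 2 μ := fun i =>
    hμ.of_le (Measurable.aestronglyMeasurable (by fun_prop))
      (.of_forall fun x => PiLp.norm_apply_le x i)
  have hint : ∀ i j, Integrable (fun x : Vec d => v i * (v j * (x i * x j))) μ := fun i j =>
    (((hc i).integrable_mul (hc j)).const_mul _).const_mul _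
  have h : ∀ x : Vec d, inner ℝ v x ^ 2 = ∑ i, ∑ j, v i * (v j * (x i * x j)) := by
    intro x
    rw [PiLp.inner_apply, sq, Finset.sum_mul_sum]
    refine Finset.sum_congr rfl fun i _ => Finset.sum_congr rfl fun j _ => ?_
    simp
    ring
  simp_rw [h]
  rw [integral_finsetSum _ fun i _ => integrable_finsetSum _ fun j _ => hint i j]
  simp_rw [integral_finsetSum _ fun j _ => hint _ j, integral_const_mul, dotProduct,
    Matrix.mulVec, dotProduct, secondMoment, Matrix.of_apply, Finset.mul_sum]
  refine Finset.sum_congr rfl fun i _ => Finset.sum_congr rfl fun j _ => ?_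
  ring

lemma lintegral_inner_sq (hμ : MemLp (fun x : Vec d => x) 2 μ) (v : Vec d) :
    ∫⁻ x, ENNReal.ofReal (inner ℝ v x ^ 2) ∂μ
      = ENNReal.ofReal (v.ofLp ⬝ᵥ (secondMoment μ).mulVec v.ofLp) := by
  rw [← integral_inner_sq_eq_dotProduct hμ, ofReal_integral_eq_lintegral_ofReal
    (hμ.const_inner v).integrable_sq (.of_forall fun _ => sq_nonneg _)]

lemma secondMoment_nonneg (hμ : MemLp (fun x : Vec d => x) 2 μ) : 0 ≤ secondMoment μ := by
  refine Matrix.nonneg_iff_posSemidef.2 (.of_dotProduct_mulVec_nonneg ?_ fun v => ?_)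
  · ext i j
    simp [secondMoment, mul_comm]
  · have := integral_inner_sq_eq_dotProduct hμ (WithLp.toLp 2 v)
    simp only [star_trivial]
    rw [← this]
    exact integral_nonneg fun _ => sq_nonneg _

end secondMoment

lemma dotProduct_mulVec_of_transpose_eq {d : ℕ} {A : Matrix (Fin d) (Fin d) ℝ}
    (hA : A.transpose = A) (u v : Fin d → ℝ) : u ⬝ᵥ A.mulVec v = A.mulVec u ⬝ᵥ v := by
  rw [Matrix.dotProduct_mulVec, ← Matrix.mulVec_transpose, hA]

lemma isHermitian_sqrt {d : ℕ} (A : Matrix (Fin d) (Fin d) ℝ) : (CFC.sqrt A).IsHermitian :=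
  (Matrix.nonneg_iff_posSemidef.mp (CFC.sqrt_nonneg A)).1

section latent
variable {d : ℕ} {P : Measure (Vec d × ℝ)}

/-- `x ↦ Σ^{-1/2} x` as a linear map. -/
noncomputable def latentL (P : Measure (Vec d × ℝ)) : Vec d →ₗ[ℝ] Vec d :=
  Matrix.toEuclideanLin (CFC.sqrt (secondMoment P.fst))⁻¹

lemma latentL_apply (x : Vec d) : latentL P x = latent P x := rfl

lemma measurable_latentL : Measurable (latentL P) :=
  (LinearMap.continuous_of_finiteDimensional _).measurable

/-- If `Σ` were singular, `Σ^{-1/2}` would be `0` by convention and the direction of the latent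
covariate would be the constant `0`. -/
lemma isUnit_det_sqrt_secondMoment [IsProbabilityMeasure P]
    (hiso : IsotropicLatent P) : IsUnit (CFC.sqrt (secondMoment P.fst)).det := by
  by_contra h
  have h0 : ∀ x, latent P x = 0 := fun x => by
    simp [latent, Matrix.nonsing_inv_apply_not_isUnit _ h]
  have hdir : (uniformSphere d) {0} = 1 := by
    rw [← hiso]
    simp [h0]
  have hsphere : (uniformSphere d) {0} = 0 := by
    rw [uniformSphere, Measure.map_apply measurable_subtype_coe (measurableSet_singleton _)]
    have : (Subtype.val ⁻¹' {0} : Set (Metric.sphere (0 : Vec d) 1)) = ∅ := by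
      ext u
      simpa using ne_zero_of_mem_unit_sphere u
    rw [this, measure_empty]
  rw [hsphere] at hdir
  exact zero_ne_one hdir

lemma sqrt_mulVec_latent (hu : IsUnit (CFC.sqrt (secondMoment P.fst)).det) (x : Vec d) :
    (CFC.sqrt (secondMoment P.fst)).mulVec (latentL P x).ofLp = x.ofLp := by
  simp [latentL, Matrix.toEuclideanLin, Matrix.mulVec_mulVec, Matrix.mul_nonsing_inv _ hu]

/-- The latent covariate has identity covariance. -/
lemma lintegral_inner_latent_sq (hP : MemLp (fun x : Vec d => x) 2 P.fst)
    (hu : IsUnit (CFC.sqrt (secondMoment P.fst)).det) (a : Vec d) :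
    ∫⁻ z, ENNReal.ofReal (inner ℝ a (latentL P z.1) ^ 2) ∂P = ENNReal.ofReal (‖a‖ ^ 2) := by
  set S := CFC.sqrt (secondMoment P.fst) with hS
  have hSS : S * S = secondMoment P.fst := CFC.sqrt_mul_sqrt_self _ (secondMoment_nonneg hP)
  have hSt : S.transpose = S := by simpa using (isHermitian_sqrt (secondMoment P.fst)).eq
  have hadj : ∀ x, inner ℝ a (latentL P x)
      = inner ℝ (WithLp.toLp 2 (S⁻¹.mulVec a.ofLp) : Vec d) x := by
    intro x
    exact (Matrix.isSymmetric_toEuclideanLin_iff.2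
      (isHermitian_sqrt (secondMoment P.fst)).inv a x).symm
  simp_rw [hadj]
  have h1 := lintegral_inner_sq hP (WithLp.toLp 2 (S⁻¹.mulVec a.ofLp) : Vec d)
  rw [← hSS, Measure.fst, lintegral_map (by fun_prop) measurable_fst] at h1
  rw [h1, ← Matrix.mulVec_mulVec, Matrix.mulVec_mulVec _ S S⁻¹, Matrix.mul_nonsing_inv _ hu,
    Matrix.one_mulVec, dotProduct_mulVec_of_transpose_eq hSt, Matrix.mulVec_mulVec,
    Matrix.mul_nonsing_inv _ hu, Matrix.one_mulVec, EuclideanSpace.real_norm_sq_eq]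
  simp [dotProduct, sq]

end latent

/-! ### Spectral decomposition -/

/-- The averaged squared error as a diagonal quadratic form in the latent residual. The matrices
`H^{1/2} Σ H^{1/2}` and `Σ^{1/2} H Σ^{1/2}` have the same spectrum, and the basis diagonalizes the
second one. -/
lemma exists_spectral_decomposition {d : ℕ} {P : Measure (Vec d × ℝ)} {ν : Measure (Vec d)}
    (hP : MemLp (fun x : Vec d => x) 2 P.fst) (hν : MemLp (fun x : Vec d => x) 2 ν)
    (hu : IsUnit (CFC.sqrt (secondMoment P.fst)).det) :
    ∃ (b : OrthonormalBasis (Fin d) ℝ (Vec d)) (ev : Fin d → ℝ), Antitone ev ∧ (∀ j, 0 ≤ ev j) ∧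
      (∀ k, eigenTail (sigmaH_isHermitian P ν) k = ∑ j : Fin d, if k ≤ (j : ℕ) then ev j else 0) ∧
      ∀ y : Vec d, y.ofLp ⬝ᵥ (secondMoment ν).mulVec y.ofLp
        = ∑ j, ev j * inner ℝ (b j) (latentL P y) ^ 2 := by
  set S := CFC.sqrt (secondMoment P.fst) with hS
  set K := CFC.sqrt (secondMoment ν) with hK
  have hSS : S * S = secondMoment P.fst := CFC.sqrt_mul_sqrt_self _ (secondMoment_nonneg hP)
  have hKK : K * K = secondMoment ν := CFC.sqrt_mul_sqrt_self _ (secondMoment_nonneg hν)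
  have hSt : S.transpose = S := by simpa using (isHermitian_sqrt (secondMoment P.fst)).eq
  have hKt : K.transpose = K := by simpa using (isHermitian_sqrt (secondMoment ν)).eq
  have hN : ((K * S).transpose * (K * S)).PosSemidef := by
    simpa using Matrix.posSemidef_conjTranspose_mul_self (K * S)
  set N := (K * S).transpose * (K * S) with hNdef
  have hN' := hN.1
  have hev : hN'.eigenvalues₀ = (sigmaH_isHermitian P ν).eigenvalues₀ := by
    have h1 : N.charpoly = (sigmaH P ν).charpoly := by
      rw [hNdef, Matrix.charpoly_mul_comm, sigmaH, ← hSS, Matrix.transpose_mul, hSt, hKt]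
      simp only [Matrix.mul_assoc]
      rfl
    rw [← List.ofFn_inj, ← Matrix.IsHermitian.sort_roots_charpoly_eq_eigenvalues₀, h1,
      Matrix.IsHermitian.sort_roots_charpoly_eq_eigenvalues₀]
  -- `e` reindexes the eigenvector basis so that the eigenvalues come in decreasing order
  set c : Fin d ≃ Fin (Fintype.card (Fin d)) := finCongr (Fintype.card_fin d).symm with hc
  set e : Fin d ≃ Fin d := c.trans (Fintype.equivOfCardEq (Fintype.card_fin _)) with he
  have hee : ∀ j, hN'.eigenvalues (e j) = hN'.eigenvalues₀ (c j) := by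
    intro j
    simp [Matrix.IsHermitian.eigenvalues, he]
  refine ⟨hN'.eigenvectorBasis.reindex e.symm, fun j => hN'.eigenvalues₀ (c j), ?_, ?_, ?_, ?_⟩
  · intro i j hij
    exact hN'.eigenvalues₀_antitone (by simpa [hc] using hij)
  · intro j
    beta_reduce
    rw [← hee]
    exact hN.eigenvalues_nonneg _
  · intro k
    rw [eigenTail, ← hev, ← c.sum_comp]
    simp [hc]
  · intro y
    set z := latentL P y with hz
    have h1 : y.ofLp ⬝ᵥ (secondMoment ν).mulVec y.ofLp = z.ofLp ⬝ᵥ N.mulVec z.ofLp := by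
      rw [← hKK, ← sqrt_mulVec_latent hu y, ← Matrix.mulVec_mulVec,
        dotProduct_mulVec_of_transpose_eq hKt, hNdef, ← Matrix.mulVec_mulVec,
        Matrix.mulVec_transpose, dotProduct_comm z.ofLp, ← Matrix.dotProduct_mulVec,
        ← Matrix.mulVec_mulVec]
    have hsym := Matrix.isSymmetric_toEuclideanLin_iff.2 hN'
    have h2 : z.ofLp ⬝ᵥ N.mulVec z.ofLp = inner ℝ z (Matrix.toEuclideanLin N z) := by
      simp [PiLp.inner_apply, dotProduct, mul_comm]
    have h3 : ∀ i, inner ℝ (hN'.eigenvectorBasis i) (Matrix.toEuclideanLin N z)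
        = hN'.eigenvalues i * inner ℝ (hN'.eigenvectorBasis i) z := by
      intro i
      rw [← hsym, ← real_inner_smul_left]
      congr 1
      ext1 p
      simpa using congrFun (hN'.mulVec_eigenvectorBasis i) p
    rw [h1, h2, ← hN'.eigenvectorBasis.sum_inner_mul_inner, ← e.sum_comp]
    refine Finset.sum_congr rfl fun j _ => ?_
    rw [h3, hee, real_inner_comm]
    simp
    ring

/-! ### Reduction of the averaged risk -/

/-- `E[ε² | X] = 0` forces the noise to vanish. -/
lemma ae_noise_eq_zero {d : ℕ} {P : Measure (Vec d × ℝ)} [IsProbabilityMeasure P]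
    (hP : WellSpecified P 0) : ∀ᵐ z ∂P, z.2 = 0 := by
  have hle : MeasurableSpace.comap (Prod.fst : Vec d × ℝ → Vec d) inferInstance
      ≤ (inferInstance : MeasurableSpace (Vec d × ℝ)) := measurable_fst.comap_le
  have h1 : ∫ z, z.2 ^ 2 ∂P = 0 := by
    rw [← integral_condExp hle, integral_congr_ae hP.condExp_noise_sq]
    simp
  rw [integral_eq_zero_iff_of_nonneg (fun _ => sq_nonneg _) hP.memLp_noise.integrable_sq] at h1
  filter_upwards [h1] with z hz
  simpa using hz

/-- The difference `x - ∑ᵢ lᵢ(x) Xᵢ`, so that the error of the rule is its inner product with `θ`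
when there is no noise. -/
noncomputable def LinearRule.residual {n d : ℕ} (f : LinearRule n d) (X : Fin n → Vec d)
    (s : f.Seed) (x : Vec d) : Vec d :=
  x - ∑ i, f.weight i x X s • X i

lemma LinearRule.measurable_residual {n d : ℕ} (f : LinearRule n d) :
    Measurable fun p : Vec d × (Fin n → Vec d) × f.Seed => f.residual p.2.1 p.2.2 p.1 := by
  have := f.measurable_weight
  unfold LinearRule.residual
  fun_prop

lemma excessRisk_eq_lintegral {n d : ℕ} {P : Measure (Vec d × ℝ)} [IsProbabilityMeasure P]
    (hP : WellSpecified P 0) (θ : Vec d) (f : LinearRule n d) :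
    excessRisk P θ f = ∫⁻ D, ∫⁻ s, ∫⁻ z, ENNReal.ofReal
      (inner ℝ (f.residual (fun i => (D i).1) s z.1) θ ^ 2) ∂P ∂f.seedLaw
      ∂(Measure.pi fun _ : Fin n => P) := by
  have h0 := ae_noise_eq_zero hP
  have hbest : risk P θ (fun x => inner ℝ x θ) = 0 := by
    rw [risk, ← lintegral_zero (μ := P)]
    refine lintegral_congr_ae ?_
    filter_upwards [h0] with z hz
    simp [response, hz]
  have hD : ∀ᵐ D ∂(Measure.pi fun _ : Fin n => P), ∀ i, (D i).2 = 0 :=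
    ae_all_iff.2 fun i =>
      (Measure.quasiMeasurePreserving_eval (fun _ : Fin n => P) i).ae h0
  rw [excessRisk, hbest, tsub_zero]
  refine lintegral_congr_ae ?_
  filter_upwards [hD] with D hD
  refine lintegral_congr fun s => lintegral_congr_ae ?_
  filter_upwards [h0] with z hz
  simp [LinearRule.residual, LinearRule.predictor, response, hz, hD, inner_sub_left, sum_inner,
    real_inner_smul_left]

/-- Averaging over `θ ∼ ν`. -/
lemma lintegral_excessRisk {n d : ℕ} {P : Measure (Vec d × ℝ)} [IsProbabilityMeasure P]
    (hP : WellSpecified P 0) {ν : Measure (Vec d)} [IsProbabilityMeasure ν]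
    (hν : MemLp (fun θ : Vec d => θ) 2 ν) (f : LinearRule n d) :
    ∫⁻ θ, excessRisk P θ f ∂ν = ∫⁻ D, ∫⁻ s, ∫⁻ z, ENNReal.ofReal
      ((f.residual (fun i => (D i).1) s z.1).ofLp ⬝ᵥ
        (secondMoment ν).mulVec (f.residual (fun i => (D i).1) s z.1).ofLp) ∂P ∂f.seedLaw
      ∂(Measure.pi fun _ : Fin n => P) := by
  have hres := f.measurable_residual
  simp_rw [excessRisk_eq_lintegral hP, ← lintegral_inner_sq hν]
  have hF : Measurable fun q : ((Vec d × (Fin n → Vec d × ℝ)) × f.Seed) × (Vec d × ℝ) =>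
      ENNReal.ofReal (inner ℝ (f.residual (fun i => (q.1.1.2 i).1) q.1.2 q.2.1) q.1.1.1 ^ 2) := by
    have hq : Measurable fun q : ((Vec d × (Fin n → Vec d × ℝ)) × f.Seed) × (Vec d × ℝ) =>
        f.residual (fun i => (q.1.1.2 i).1) q.1.2 q.2.1 :=
      hres.comp (f := fun q : ((Vec d × (Fin n → Vec d × ℝ)) × f.Seed) × (Vec d × ℝ) =>
        (q.2.1, (fun i => (q.1.1.2 i).1), q.1.2)) (by fun_prop)
    fun_prop
  rw [lintegral_lintegral_swap hF.lintegral_prod_right'.lintegral_prod_right'.aemeasurable]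
  refine lintegral_congr fun D => ?_
  have hF1 := hF.comp (f := fun q : (Vec d × f.Seed) × (Vec d × ℝ) =>
    (((q.1.1, D), q.1.2), q.2)) (by fun_prop)
  rw [lintegral_lintegral_swap hF1.lintegral_prod_right'.aemeasurable]
  refine lintegral_congr fun s => ?_
  have hF2 := hF1.comp (f := fun q : Vec d × (Vec d × ℝ) => ((q.1, s), q.2)) (by fun_prop)
  rw [lintegral_lintegral_swap]
  exact hF2.aemeasurable

/-! ### The lower bound -/

/-- The variational principle behind the tail `∑_{j > n} λ_j`: among weights in `[0, 1]` of total
mass at least `d - n`, the weighted sum of the eigenvalues is smallest when the mass sits on the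
smallest ones. -/
lemma sum_tail_le_sum_mul {n d : ℕ} (hnd : n < d) {ev : Fin d → ℝ} (hanti : Antitone ev)
    (hnonneg : ∀ j, 0 ≤ ev j) {s : Fin d → ℝ} (hs0 : ∀ j, 0 ≤ s j) (hs1 : ∀ j, s j ≤ 1)
    (hsum : (d : ℝ) ≤ ∑ j, s j + n) :
    ∑ j : Fin d, (if n ≤ (j : ℕ) then ev j else 0) ≤ ∑ j, ev j * s j := by
  -- every summand is compared with the one in which `ev j` is replaced by the threshold value `c`
  set c := ev ⟨n, hnd⟩ with hc
  have hterm : ∀ j : Fin d, c * (s j - if n ≤ (j : ℕ) then 1 else 0)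
      ≤ ev j * s j - if n ≤ (j : ℕ) then ev j else 0 := by
    intro j
    split_ifs with h
    · have h1 : ev j ≤ c := hanti (by simpa [Fin.le_def] using h)
      nlinarith [hs1 j]
    · have h1 : c ≤ ev j := hanti (by simp [Fin.le_def]; omega)
      nlinarith [hs0 j]
  have hcount : ∑ j : Fin d, (if n ≤ (j : ℕ) then (1 : ℝ) else 0) = d - n := by
    rw [Fin.sum_univ_eq_sum_range (fun j => if n ≤ j then (1 : ℝ) else 0) d, ← Finset.sum_filter,
      Finset.sum_const, nsmul_one]
    have : (Finset.range d).filter (fun j => n ≤ j) = Finset.Ico n d := by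
      ext j
      simp [and_comm]
    rw [this, Nat.card_Ico, Nat.cast_sub hnd.le]
  have h := Finset.sum_le_sum fun j (_ : j ∈ Finset.univ) => hterm j
  rw [← Finset.mul_sum, Finset.sum_sub_distrib, Finset.sum_sub_distrib, hcount] at h
  have h0 : 0 ≤ c * (∑ j, s j - (d - n)) := mul_nonneg (hnonneg _) (by linarith)
  linarith

/-- Whatever the weights, the residual differs from the latent covariate by an element of the span
of `n` fixed vectors. Projecting orthogonally to the image of that span under the square root `B` of
the quadratic form removes this element, and leaves a mean square at least the eigenvalue tail. -/
lemma ofReal_tail_le_lintegral {n d : ℕ} (hnd : n < d) {P : Measure (Vec d × ℝ)}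
    (hP : MemLp (fun x : Vec d => x) 2 P.fst)
    (hu : IsUnit (CFC.sqrt (secondMoment P.fst)).det)
    (b : OrthonormalBasis (Fin d) ℝ (Vec d)) {ev : Fin d → ℝ} (hanti : Antitone ev)
    (hnonneg : ∀ j, 0 ≤ ev j) (z : Fin n → Vec d) (l : Vec d → Fin n → ℝ) :
    ENNReal.ofReal (∑ j : Fin d, if n ≤ (j : ℕ) then ev j else 0)
      ≤ ∫⁻ p, ENNReal.ofReal
          (∑ j, ev j * inner ℝ (b j) (latentL P p.1 - ∑ i, l p.1 i • z i) ^ 2) ∂P := by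
  set B : Vec d →ₗ[ℝ] Vec d :=
    ∑ j, √(ev j) • (LinearMap.toSpanSingleton ℝ (Vec d) (b j) ∘ₗ (innerₗ (Vec d) (b j))) with hB
  have hBapply : ∀ v, B v = ∑ j, (√(ev j) * inner ℝ (b j) v) • b j := fun v => by
    simp [hB, LinearMap.sum_apply, smul_smul]
  have hBinner : ∀ j v, inner ℝ (b j) (B v) = √(ev j) * inner ℝ (b j) v := fun j v => by
    simp [hBapply, inner_sum, inner_smul_right, b.inner_eq_ite]
  have hBsym : ∀ v w, inner ℝ v (B w) = inner ℝ (B v) w := fun v w => by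
    rw [← b.sum_inner_mul_inner, ← b.sum_inner_mul_inner (B v)]
    refine Finset.sum_congr rfl fun j _ => ?_
    rw [hBinner, real_inner_comm (b j) (B v), hBinner, real_inner_comm (b j) v]
    ring
  have hBnorm : ∀ v, ‖B v‖ ^ 2 = ∑ j, ev j * inner ℝ (b j) v ^ 2 := fun v => by
    rw [← b.sum_sq_inner_right]
    refine Finset.sum_congr rfl fun j _ => ?_
    rw [hBinner, mul_pow, Real.sq_sqrt (hnonneg j)]
  set U := Submodule.span ℝ (range fun i => B (z i)) with hU
  set q := stdOrthonormalBasis ℝ Uᗮ with hq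
  have hproj : ∀ v, ‖Uᗮ.orthogonalProjectionOnto v‖ ^ 2 = ∑ i, inner ℝ (q i : Vec d) v ^ 2 := by
    intro v
    rw [← q.sum_sq_inner_right]
    simp_rw [Submodule.inner_orthogonalProjectionOnto_eq_of_mem_left]
  have hrank : d ≤ Module.finrank ℝ Uᗮ + n := by
    have h1 := Submodule.finrank_add_finrank_orthogonal U
    have h2 : Module.finrank ℝ U ≤ n := by
      exact (finrank_range_le_card (R := ℝ) fun i => B (z i)).trans_eq (Fintype.card_fin n)
    rw [finrank_euclideanSpace, Fintype.card_fin] at h1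
    omega
  have hpoint : ∀ p : Vec d × ℝ, ∑ i, inner ℝ (B (q i : Vec d)) (latentL P p.1) ^ 2
      ≤ ∑ j, ev j * inner ℝ (b j) (latentL P p.1 - ∑ i, l p.1 i • z i) ^ 2 := by
    intro p
    simp_rw [← hBnorm, ← hBsym]
    rw [← hproj]
    have h0 : ∀ i, Uᗮ.orthogonalProjectionOnto (B (z i)) = 0 := fun i => by
      rw [Submodule.orthogonalProjectionOnto_eq_zero_iff]
      exact Submodule.le_orthogonal_orthogonal _ (Submodule.subset_span ⟨i, rfl⟩)
    have h1 : Uᗮ.orthogonalProjectionOnto (B (latentL P p.1))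
        = Uᗮ.orthogonalProjectionOnto (B (latentL P p.1 - ∑ i, l p.1 i • z i)) := by
      simp [h0]
    rw [h1]
    have := Uᗮ.norm_orthogonalProjectionOnto_apply_le
      (B (latentL P p.1 - ∑ i, l p.1 i • z i))
    gcongr
  have hmeas := measurable_latentL (P := P)
  refine le_trans ?_ (lintegral_mono fun p => ENNReal.ofReal_le_ofReal (hpoint p))
  simp_rw [ENNReal.ofReal_sum_of_nonneg fun i _ => sq_nonneg _]
  rw [lintegral_finsetSum _ fun i _ => by fun_prop]
  simp_rw [lintegral_inner_latent_sq hP hu]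
  rw [← ENNReal.ofReal_sum_of_nonneg fun i _ => sq_nonneg _]
  refine ENNReal.ofReal_le_ofReal ?_
  simp_rw [hBnorm]
  rw [Finset.sum_comm]
  simp_rw [← Finset.mul_sum, real_inner_comm (_ : Vec d) (b _)]
  refine sum_tail_le_sum_mul hnd hanti hnonneg (fun j => Finset.sum_nonneg fun i _ => sq_nonneg _)
    (fun j => ?_) ?_
  · rw [← hproj]
    have := Uᗮ.norm_orthogonalProjectionOnto_apply_le (b j)
    rw [b.norm_eq_one] at this
    exact pow_le_one₀ (norm_nonneg _) this
  · rw [Finset.sum_comm]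
    simp_rw [b.sum_sq_inner_left]
    simp only [Submodule.norm_coe, q.norm_eq_one]
    simp
    exact_mod_cast hrank

/-! ### The upper bound -/

section upper
variable {n d k : ℕ}

/-- The rows of the array of coordinates of `g₁, …, gₙ` in an orthonormal basis. -/
noncomputable def rows (b : OrthonormalBasis (Fin d) ℝ (Vec d)) (g : Fin n → Vec d) :
    Fin d → Vec n :=
  fun j => WithLp.toLp 2 fun i => inner ℝ (b j) (g i)

lemma measurable_rows (b : OrthonormalBasis (Fin d) ℝ (Vec d)) :
    Measurable (rows (n := n) b) := by
  unfold rows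
  fun_prop

/-- The direction of the latent covariate, rescaled to have length `|r|`; it is `0` where the latent
covariate vanishes. -/
noncomputable def rescaledLatent (P : Measure (Vec d × ℝ)) (x : Vec d) (r : ℝ) : Vec d :=
  r • ‖latentL P x‖⁻¹ • latentL P x

lemma measurable_rescaledLatent (P : Measure (Vec d × ℝ)) :
    Measurable fun p : Vec d × ℝ => rescaledLatent P p.1 p.2 := by
  have := measurable_latentL (P := P)
  unfold rescaledLatent
  fun_prop

/-- Rescaling the isotropic latent directions by independent Gaussian radii makes the array of
coordinates exactly Gaussian, whatever the law of the lengths. -/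
lemma measurePreserving_rows_rescaledLatent (hd : 0 < d) {P : Measure (Vec d × ℝ)}
    [IsProbabilityMeasure P] (hiso : IsotropicLatent P)
    (b : OrthonormalBasis (Fin d) ℝ (Vec d)) :
    MeasurePreserving (fun p : (Fin n → Vec d × ℝ) × (Fin n → ℝ) =>
        rows b fun i => rescaledLatent P (p.1 i).1 (p.2 i))
      ((Measure.pi fun _ => P).prod (Measure.pi fun _ => gaussianRadius d))
      (Measure.pi fun _ => stdGaussian (Vec n)) := by
  have hm := measurable_latentL (P := P)
  have h1 : MeasurePreserving (fun z : Vec d × ℝ => ‖latentL P z.1‖⁻¹ • latentL P z.1) P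
      (uniformSphere d) := by
    refine ⟨by fun_prop, ?_⟩
    have h := hiso
    simp_rw [IsotropicLatent, Measure.fst, ← latentL_apply] at h
    rw [Measure.map_map (by fun_prop) measurable_fst] at h
    exact h
  have h2 : MeasurePreserving (fun p : Vec d × ℝ => p.2 • p.1)
      ((uniformSphere d).prod (gaussianRadius d)) (stdGaussian (Vec d)) :=
    ⟨by fun_prop, map_smul_uniformSphere_prod_gaussianRadius hd⟩
  have h3 := h2.comp (h1.prod (MeasurePreserving.id (gaussianRadius d)))
  have h4 := measurePreserving_pi (fun _ : Fin n => P.prod (gaussianRadius d))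
    (fun _ => stdGaussian (Vec d)) fun _ => h3
  have h5 := (measurePreserving_arrowProdEquivProdArrow (Vec d × ℝ) ℝ (Fin n) (fun _ => P)
    (fun _ => gaussianRadius d)).symm
  have h6 : MeasurePreserving (rows (n := n) b) (Measure.pi fun _ => stdGaussian (Vec d))
      (Measure.pi fun _ => stdGaussian (Vec n)) :=
    ⟨measurable_rows b, map_transpose_pi_stdGaussian b⟩
  exact h6.comp (h4.comp h5)

/-- The rule that recovers exactly the first `k` coordinates of the latent covariate in the basis
`b`, by inverting (in the least-norm sense) the first `k` rows of the Gaussian array obtained by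
rescaling the training points. The seed holds the Gaussian radii. -/
noncomputable def gaussianRule (n : ℕ) (P : Measure (Vec d × ℝ))
    (b : OrthonormalBasis (Fin d) ℝ (Vec d)) (e : Fin k → Fin d) : LinearRule n d where
  Seed := Fin n → ℝ
  seedLaw := Measure.pi fun _ => gaussianRadius d
  weight i x X s := s i * ‖latentL P (X i)‖⁻¹ *
    ∑ m, inner ℝ (b (e m)) (latentL P x) *
      dualVec (rows b (fun i => rescaledLatent P (X i) (s i)) ∘ e) m i
  measurable_weight i := by
    have hm := measurable_latentL (P := P)
    have hr : Measurable fun p : Vec d × (Fin n → Vec d) × (Fin n → ℝ) =>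
        rows b (fun i => rescaledLatent P (p.2.1 i) (p.2.2 i)) :=
      (measurable_rows b).comp (measurable_pi_lambda _ fun i =>
        (measurable_rescaledLatent P).comp
          (f := fun p : Vec d × (Fin n → Vec d) × (Fin n → ℝ) => (p.2.1 i, p.2.2 i)) (by fun_prop))
    have hw : ∀ m, Measurable fun p : Vec d × (Fin n → Vec d) × (Fin n → ℝ) =>
        dualVec (rows b (fun i => rescaledLatent P (p.2.1 i) (p.2.2 i)) ∘ e) m := fun m =>
      (measurable_dualVec m).comp (measurable_pi_lambda _ fun p => (measurable_pi_apply _).comp hr)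
    fun_prop

/-- The coefficient vector `b_j - ∑_m ⟪w_m, A_j⟫ b_m` whose inner product with the latent covariate
is the `j`-th coordinate of the latent residual of the Gaussian rule. -/
noncomputable def residualCoeff (b : OrthonormalBasis (Fin d) ℝ (Vec d)) (e : Fin k → Fin d)
    (A : Fin d → Vec n) (j : Fin d) : Vec d :=
  b j - ∑ m, (inner ℝ (dualVec (A ∘ e) m) (A j) : ℝ) • b (e m)

lemma measurable_residualCoeff (b : OrthonormalBasis (Fin d) ℝ (Vec d)) (e : Fin k → Fin d)
    (j : Fin d) : Measurable fun A : Fin d → Vec n => residualCoeff b e A j := by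
  have hw : ∀ m, Measurable fun A : Fin d → Vec n => dualVec (A ∘ e) m := fun m =>
    (measurable_dualVec m).comp (by fun_prop)
  unfold residualCoeff
  fun_prop

lemma inner_latent_residual_gaussianRule (P : Measure (Vec d × ℝ))
    (b : OrthonormalBasis (Fin d) ℝ (Vec d)) (e : Fin k → Fin d) (X : Fin n → Vec d)
    (s : Fin n → ℝ) (x : Vec d) (j : Fin d) :
    inner ℝ (b j) (latentL P ((gaussianRule n P b e).residual X s x))
      = inner ℝ (residualCoeff b e (rows b fun i => rescaledLatent P (X i) (s i)) j)
          (latentL P x) := by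
  set A := rows b fun i => rescaledLatent P (X i) (s i) with hA
  have h1 : ∀ i, inner ℝ (b j) (latentL P (X i)) * (s i * ‖latentL P (X i)‖⁻¹) = A j i := by
    intro i
    simp only [hA, rows, rescaledLatent, inner_smul_right]
    ring
  have h2 : latentL P ((gaussianRule n P b e).residual X s x) = latentL P x - ∑ i,
      (s i * ‖latentL P (X i)‖⁻¹ * ∑ m, inner ℝ (b (e m)) (latentL P x) * dualVec (A ∘ e) m i)
        • latentL P (X i) := by
    simp only [LinearRule.residual, map_sub, map_sum, map_smul]
    rfl
  rw [h2, inner_sub_right, inner_sum, residualCoeff, inner_sub_left, sum_inner]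
  congr 1
  simp_rw [inner_smul_right, real_inner_smul_left]
  calc _ = ∑ i, ∑ m, A j i * (inner ℝ (b (e m)) (latentL P x) * dualVec (A ∘ e) m i) := by
        refine Finset.sum_congr rfl fun i _ => ?_
        rw [← Finset.mul_sum, ← h1]
        ring
    _ = _ := by
        rw [Finset.sum_comm]
        refine Finset.sum_congr rfl fun m _ => ?_
        rw [PiLp.inner_apply (dualVec (A ∘ e) m), Finset.sum_mul]
        refine Finset.sum_congr rfl fun i _ => ?_
        simp
        ring

lemma norm_sq_residualCoeff (b : OrthonormalBasis (Fin d) ℝ (Vec d)) {e : Fin k → Fin d}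
    (he : Function.Injective e) (A : Fin d → Vec n) {j : Fin d} (hj : ∀ p, e p ≠ j) :
    ‖residualCoeff b e A j‖ ^ 2 = 1 + ∑ m, inner ℝ (dualVec (A ∘ e) m) (A j) ^ 2 := by
  have h0 : inner ℝ (b j) (∑ m, (inner ℝ (dualVec (A ∘ e) m) (A j) : ℝ) • b (e m)) = 0 := by
    simp [inner_sum, inner_smul_right, b.inner_eq_ite, fun m => (hj m).symm]
  have h1 := (b.orthonormal.comp e he).inner_sum
    (fun m => (inner ℝ (dualVec (A ∘ e) m) (A j) : ℝ))
    (fun m => (inner ℝ (dualVec (A ∘ e) m) (A j) : ℝ)) Finset.univ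
  simp only [Function.comp_apply, conj_trivial, ← sq] at h1
  rw [residualCoeff, norm_sub_sq_real, h0, b.norm_eq_one, ← real_inner_self_eq_norm_sq (∑ _, _), h1]
  ring

/-- The first `k` coordinates are reproduced exactly, by duality of `dualVec` and the rows. -/
lemma residualCoeff_eq_zero (b : OrthonormalBasis (Fin d) ℝ (Vec d)) {e : Fin k → Fin d}
    {A : Fin d → Vec n} (hA : LinearIndependent ℝ (A ∘ e)) (p : Fin k) :
    residualCoeff b e A (e p) = 0 := by
  have h : ∀ m, inner ℝ (dualVec (A ∘ e) m) (A (e p)) = if m = p then (1 : ℝ) else 0 :=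
    fun m => inner_dualVec hA m p
  simp [residualCoeff, h]

/-- The mean error of the Gaussian rule: the first `k` coordinates contribute nothing, and each of
the others contributes `1 + k / (n - k - 1)`. -/
lemma lintegral_residualCoeff_le (hk : k + 1 < n) (b : OrthonormalBasis (Fin d) ℝ (Vec d))
    {e : Fin k → Fin d} (he : Function.Injective e) {ev : Fin d → ℝ} (hnonneg : ∀ j, 0 ≤ ev j) :
    ∫⁻ A, ∑ j, ENNReal.ofReal (ev j) * ENNReal.ofReal (‖residualCoeff b e A j‖ ^ 2)
        ∂(Measure.pi fun _ : Fin d => stdGaussian (Vec n))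
      ≤ ENNReal.ofReal (((n : ℝ) - 1) / ((n : ℝ) - k - 1)
          * ∑ j, if j ∈ range e then 0 else ev j) := by
  classical
  have hk' : (0 : ℝ) < (n : ℝ) - k - 1 := by
    have : (k : ℝ) + 1 < n := by exact_mod_cast hk
    linarith
  have hw : ∀ m, Measurable fun A : Fin d → Vec n => dualVec (A ∘ e) m := fun m =>
    (measurable_dualVec m).comp (by fun_prop)
  have hcoeff : ∀ j, Measurable fun A : Fin d → Vec n => residualCoeff b e A j :=
    measurable_residualCoeff b e
  rw [lintegral_finsetSum _ fun j _ => by fun_prop, Finset.mul_sum, ENNReal.ofReal_sum_of_nonneg]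
  swap
  · intro j _
    have h1 : (0 : ℝ) ≤ (n : ℝ) - 1 := by
      have : (0 : ℝ) ≤ k := k.cast_nonneg
      linarith
    split_ifs
    · simp
    · exact mul_nonneg (div_nonneg h1 hk'.le) (hnonneg j)
  refine Finset.sum_le_sum fun j _ => ?_
  rw [lintegral_const_mul _ (by fun_prop)]
  split_ifs with hj
  · obtain ⟨p, rfl⟩ := hj
    have h0 : ∫⁻ A, ENNReal.ofReal (‖residualCoeff b e A (e p)‖ ^ 2)
        ∂(Measure.pi fun _ : Fin d => stdGaussian (Vec n)) = 0 := by
      rw [lintegral_eq_zero_iff (by fun_prop)]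
      filter_upwards [ae_linearIndependent_pi_stdGaussian hk he] with A hA
      simp [residualCoeff_eq_zero b hA]
    rw [h0, mul_zero]
    exact zero_le
  · have hj' : ∀ p, e p ≠ j := fun p hp => hj ⟨p, hp⟩
    rw [mul_comm (_ / _) (ev j), ENNReal.ofReal_mul (hnonneg j)]
    gcongr
    simp_rw [norm_sq_residualCoeff b he _ hj', ENNReal.ofReal_add zero_le_one
      (Finset.sum_nonneg fun _ _ => sq_nonneg _), ENNReal.ofReal_sum_of_nonneg fun _ _ => sq_nonneg _]
    rw [lintegral_add_left measurable_const, lintegral_finsetSum _ fun m _ => by fun_prop]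
    have h2 : ∀ m, ∫⁻ A, ENNReal.ofReal (inner ℝ (dualVec (A ∘ e) m) (A j) ^ 2)
        ∂(Measure.pi fun _ : Fin d => stdGaussian (Vec n)) ≤ ENNReal.ofReal (1 / ((n : ℝ) - k - 1)) :=
      fun m => (lintegral_inner_dualVec_sq_le m hj').trans (lintegral_norm_sq_dualVec_le hk he m)
    refine (add_le_add_right (Finset.sum_le_sum fun m _ => h2 m) _).trans_eq ?_
    rw [← ENNReal.ofReal_sum_of_nonneg fun _ _ => by positivity]
    simp only [lintegral_const, measure_univ, mul_one, Finset.sum_const, Finset.card_univ,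
      Fintype.card_fin, nsmul_eq_mul]
    rw [← ENNReal.ofReal_add zero_le_one (by positivity)]
    congr 1
    field_simp
    ring

end upper

end LinReg

theorem mainTheorem4 (n d : ℕ) (hd : n + 2 < d)
    (P : Measure (LinReg.Vec d × ℝ)) [IsProbabilityMeasure P]
    (hP : LinReg.WellSpecified P 0) (hiso : LinReg.IsotropicLatent P)
    (ν : Measure (LinReg.Vec d)) [IsProbabilityMeasure ν]
    (hν : MemLp (fun θ : LinReg.Vec d => θ) 2 ν) :
    ENNReal.ofReal (LinReg.eigenTail (LinReg.sigmaH_isHermitian P ν) n)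
        ≤ LinReg.optimalExcessRisk n P ν ∧
      LinReg.optimalExcessRisk n P ν
        ≤ ⨅ (k : ℕ) (_ : k + 1 < n),
            ENNReal.ofReal (((n : ℝ) - 1) / ((n : ℝ) - (k : ℝ) - 1)
              * LinReg.eigenTail (LinReg.sigmaH_isHermitian P ν) k) := by
  have hX := hP.memLp_covariate
  have hu := LinReg.isUnit_det_sqrt_secondMoment hiso
  obtain ⟨b, ev, hanti, hnonneg, htail, hquad⟩ := LinReg.exists_spectral_decomposition hX hν hu
  have hmeas := LinReg.measurable_latentL (P := P)
  have hrisk : ∀ f : LinReg.LinearRule n d, ∫⁻ θ, LinReg.excessRisk P θ f ∂ν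
      = ∫⁻ D, ∫⁻ s, ∫⁻ z, ENNReal.ofReal (∑ j, ev j * inner ℝ (b j)
          (LinReg.latentL P (f.residual (fun i => (D i).1) s z.1)) ^ 2) ∂P ∂f.seedLaw
          ∂(Measure.pi fun _ : Fin n => P) := by
    intro f
    simp_rw [LinReg.lintegral_excessRisk hP hν, hquad]
  constructor
  · refine le_iInf fun f => ?_
    rw [hrisk, htail]
    have h1 : ∀ (D : Fin n → LinReg.Vec d × ℝ) (s : f.Seed),
        ENNReal.ofReal (∑ j : Fin d, if n ≤ (j : ℕ) then ev j else 0)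
          ≤ ∫⁻ z, ENNReal.ofReal (∑ j, ev j * inner ℝ (b j)
            (LinReg.latentL P (f.residual (fun i => (D i).1) s z.1)) ^ 2) ∂P := by
      intro D s
      refine (LinReg.ofReal_tail_le_lintegral (by omega) hX hu b hanti hnonneg
        (fun i => LinReg.latentL P (D i).1)
        (fun x i => f.weight i x (fun i => (D i).1) s)).trans_eq ?_
      simp [LinReg.LinearRule.residual]
    calc ENNReal.ofReal (∑ j : Fin d, if n ≤ (j : ℕ) then ev j else 0)
        = ∫⁻ _, ∫⁻ _, ENNReal.ofReal (∑ j : Fin d, if n ≤ (j : ℕ) then ev j else 0) ∂f.seedLaw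
          ∂(Measure.pi fun _ : Fin n => P) := by simp
      _ ≤ _ := lintegral_mono fun D => lintegral_mono fun s => h1 D s
  · refine le_iInf₂ fun k hk => ?_
    set e : Fin k → Fin d := Fin.castLE (by omega) with he
    have hinj : Function.Injective e := Fin.castLE_injective _
    refine (iInf_le _ (LinReg.gaussianRule n P b e)).trans ?_
    rw [hrisk, htail]
    have hrange : ∀ j, (if j ∈ Set.range e then 0 else ev j) = if k ≤ (j : ℕ) then ev j else 0 := by
      intro j
      have hmem : j ∈ Set.range e ↔ ¬ k ≤ (j : ℕ) := by
        rw [he, Fin.range_castLE, not_le]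
        rfl
      rw [if_congr hmem rfl rfl, ite_not]
    have hmain := LinReg.lintegral_residualCoeff_le hk b hinj hnonneg
    have hpres := LinReg.measurePreserving_rows_rescaledLatent (n := n) (by omega) hiso b
    simp_rw [hrange] at hmain
    have hinner : ∀ (D : Fin n → LinReg.Vec d × ℝ) (s : Fin n → ℝ),
        ∫⁻ z, ENNReal.ofReal (∑ j, ev j * inner ℝ (b j) (LinReg.latentL P
          ((LinReg.gaussianRule n P b e).residual (fun i => (D i).1) s z.1)) ^ 2) ∂P
        = ∑ j, ENNReal.ofReal (ev j) * ENNReal.ofReal (‖LinReg.residualCoeff b e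
          (LinReg.rows b fun i => LinReg.rescaledLatent P (D i).1 (s i)) j‖ ^ 2) := by
      intro D s
      simp_rw [LinReg.inner_latent_residual_gaussianRule]
      simp_rw [ENNReal.ofReal_sum_of_nonneg fun j _ => mul_nonneg (hnonneg j) (sq_nonneg _),
        ENNReal.ofReal_mul (hnonneg _)]
      rw [lintegral_finsetSum _ fun j _ => by fun_prop]
      refine Finset.sum_congr rfl fun j _ => ?_
      rw [lintegral_const_mul _ (by fun_prop), LinReg.lintegral_inner_latent_sq hX hu]
    have hΦ : Measurable fun A : Fin d → LinReg.Vec n => ∑ j, ENNReal.ofReal (ev j) *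
        ENNReal.ofReal (‖LinReg.residualCoeff b e A j‖ ^ 2) := by
      have := LinReg.measurable_residualCoeff (n := n) b e
      fun_prop
    rw [← hpres.lintegral_comp hΦ] at hmain
    refine le_trans (le_of_eq ?_)
      ((lintegral_prod _ (hΦ.comp hpres.measurable).aemeasurable).symm.trans_le hmain)
    exact lintegral_congr fun D => lintegral_congr fun s => hinner D s
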